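/- For $a\in\mathbb R$ let $R_y(a)=e^{-iaY/2}$ and $R_z(a)=e^{-iaZ/2}$, where $Y,Z$ are the Pauli matrices. A single-qubit circuit on $[0,1]^M$ is a map $U:[0,1]^M\to\mathcal U(2)$ of the data re-uploading form $$U(x)=\prod_{l=1}^{L}R_y(\theta_{0,l})\Big(\prod_{m=1}^{M}R_z(x_m\theta_{m,l})\Big)R_z(\theta_{M+1,l})$$ for some number of layers $L\in\mathbb N$ and some parameters $\theta\in\mathbb R^{(M+2)\times L}$ that do not depend on $x$. A map $f$ on $[0,1]^M$ is called piecewise continuous if $[0,1]^M$ is a union of finitely or countably many pieces, each the intersection of an open and a closed set, such that the restriction of $f$ to every piece is continuous. **Theorem.** For every natural number $M$ and every piecewise continuous map $f:[0,1]^M\to[-1,1]^M$ there is a sequence, indexed by $k$, of $M$-tuples $(U_{k,m},O_{k,m})_{1\le m\le M}$ of single-qubit circuits $U_{k,m}:[0,1]^M\to\mathcal U(2)$ and Hermitian observables $O_{k,m}\in\mathbb C^{2\times 2}$ of spectral norm $\|O_{k,m}\|=1$, such that the functions $g_k:[0,1]^M\to\mathbb R^M$ defined by $$g_{k,m}(x)=\langle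 0|\,U_{k,m}(x)^\dagger\, O_{k,m}\, U_{k,m}(x)\,|0\rangle$$ converge pointwise to $f$, that is, $\lim_{k\to\infty}g_k(x)=f(x)$ for every $x\in[0,1]^M$. -/

import Mathlib

open Filter Topology
open scoped Matrix Matrix.Norms.L2Operator

noncomputable section

/-- A map between topological spaces is piecewise continuous if its domain is covered by countably
many pieces, each locally closed (the intersection of an open and a closed set), such that the
restriction of the map to every piece is continuous. Pieces may be empty, so that finite families
of pieces are included; the pieces need not be disjoint, so that partitions are included. -/
def PiecewiseContinuous {X Y : Type*} [TopologicalSpace X] [TopologicalSpace Y] (f : X → Y) :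
    Prop :=
  ∃ A : ℕ → Set X, (∀ n, IsLocallyClosed (A n)) ∧ (⋃ n, A n) = Set.univ ∧
    ∀ n, ContinuousOn f (A n)

/-- The matrix of the rotation `exp (- i a Y / 2)`. -/
def rotYMatrix (a : ℝ) : Matrix (Fin 2) (Fin 2) ℂ :=
  !![(Real.cos (a / 2) : ℂ), -(Real.sin (a / 2) : ℂ);
     (Real.sin (a / 2) : ℂ), (Real.cos (a / 2) : ℂ)]

/-- The matrix of the rotation `exp (- i a Z / 2)`. -/
def rotZMatrix (a : ℝ) : Matrix (Fin 2) (Fin 2) ℂ :=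
  !![Complex.exp (-(Complex.I * (a / 2))), 0;
     0, Complex.exp (Complex.I * (a / 2))]

theorem rotYMatrix_mem (a : ℝ) : rotYMatrix a ∈ Matrix.unitaryGroup (Fin 2) ℂ := by
  have h : (Real.cos (a / 2) : ℂ) ^ 2 + (Real.sin (a / 2) : ℂ) ^ 2 = 1 := by
    exact_mod_cast Real.cos_sq_add_sin_sq (a / 2)
  rw [Matrix.mem_unitaryGroup_iff]
  ext i j
  fin_cases i <;> fin_cases j <;>
    simp [rotYMatrix, Matrix.mul_apply, Fin.sum_univ_two, Matrix.star_apply,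
      -Complex.ofReal_cos, -Complex.ofReal_sin] <;>
    first | linear_combination h | ring

theorem rotZMatrix_mem (a : ℝ) : rotZMatrix a ∈ Matrix.unitaryGroup (Fin 2) ℂ := by
  rw [Matrix.mem_unitaryGroup_iff]
  ext i j
  fin_cases i <;> fin_cases j <;>
    simp [rotZMatrix, Matrix.mul_apply, Fin.sum_univ_two, Matrix.star_apply,
      ← Complex.exp_conj, ← Complex.exp_add, map_ofNat (starRingEnd ℂ) 2]

/-- The single-qubit gate `R_y(a)`. -/
def rotY (a : ℝ) : Matrix.unitaryGroup (Fin 2) ℂ := ⟨rotYMatrix a, rotYMatrix_mem a⟩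

/-- The single-qubit gate `R_z(a)`. -/
def rotZ (a : ℝ) : Matrix.unitaryGroup (Fin 2) ℂ := ⟨rotZMatrix a, rotZMatrix_mem a⟩

/-- The single-qubit data re-uploading circuit with `L` layers, inputs `x 0, …, x (M - 1)` and
parameters `θ`. Layer `l` is
`R_y(θ 0 l) * (∏ m, R_z(x m * θ (m + 1) l)) * R_z(θ (M + 1) l)`. -/
def reuploadingCircuit {M L : ℕ} (θ : Matrix (Fin (M + 2)) (Fin L) ℝ) (x : Fin M → ℝ) :
    Matrix.unitaryGroup (Fin 2) ℂ :=
  (List.ofFn fun l : Fin L =>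
    rotY (θ 0 l) * (List.ofFn fun m : Fin M => rotZ (x m * θ m.succ.castSucc l)).prod *
      rotZ (θ (Fin.last (M + 1)) l)).prod

/-- The unit cube `[0,1]^M`. -/
abbrev UnitCube (M : ℕ) : Set (Fin M → ℝ) := Set.Icc 0 1

/-- `U : [0,1]^M → U(2)` is a single-qubit circuit: it is a data re-uploading circuit with finitely
many layers and with parameters that do not depend on the input. -/
def IsSingleQubitCircuit {M : ℕ} (U : UnitCube M → Matrix.unitaryGroup (Fin 2) ℂ) : Prop :=
  ∃ (L : ℕ) (θ : Matrix (Fin (M + 2)) (Fin L) ℝ), ∀ x, U x = reuploadingCircuit θ x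

/-- The computational basis state `|0⟩`. -/
def ketZero : Fin 2 → ℂ := ![1, 0]

/-- The expectation value `⟨0| Uᴴ O U |0⟩`. -/
def expectationValue (U : Matrix.unitaryGroup (Fin 2) ℂ) (O : Matrix (Fin 2) (Fin 2) ℂ) : ℂ :=
  star ketZero ⬝ᵥ (((U : Matrix (Fin 2) (Fin 2) ℂ)ᴴ * O * (U : Matrix (Fin 2) (Fin 2) ℂ)) *ᵥ
    ketZero)

end

open ContinuousMap

noncomputable section

/-! ### Rotations -/

/-! On `|0⟩`, the observable `Z` has expectation `cos a` after `R_y(a)`, so it suffices to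
approximate `x ↦ R_y(p x)` uniformly for continuous `p` with `cos ∘ p = f m` on a large closed set.

Conjugating `R_y(s)` by `R_z(±φ)` tilts its axis. In the product of the two conjugates the tilts
cancel to first order, leaving `R_y(2 s cos φ)`. Trotter powers remove the error, so every angle `t
cos φ` with `φ` affine is reachable (`cosComp_mem_reachableAngles`). Reachable angles form a closed
linear space, and cosines of affine phases span a point-separating algebra, so Stone–Weierstrass
makes every continuous angle reachable (`reachableAngles_eq_top`).

For piecewise continuous `f`, closed sets `K k` on which `f` is continuous eventually contain each
point. Tietze extends `arccos (f m)` from `K k`, and the `k`-th circuit approximates that extension.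
-/

theorem rotY_zero : rotY 0 = 1 := by
  ext i j
  fin_cases i <;> fin_cases j <;> simp [rotY, rotYMatrix]

theorem rotZ_zero : rotZ 0 = 1 := by
  ext i j
  fin_cases i <;> fin_cases j <;> simp [rotZ, rotZMatrix]

theorem rotY_add (a b : ℝ) : rotY (a + b) = rotY a * rotY b := by
  ext i j
  fin_cases i <;> fin_cases j <;>
    simp [rotY, rotYMatrix, add_div, Complex.cos_add, Complex.sin_add] <;> ring

theorem rotZ_add (a b : ℝ) : rotZ (a + b) = rotZ a * rotZ b := by
  ext i j
  fin_cases i <;> fin_cases j <;>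
    simp [rotZ, rotZMatrix, ← Complex.exp_add] <;> ring_nf

theorem rotY_nsmul (n : ℕ) (a : ℝ) : rotY (n * a) = rotY a ^ n := by
  induction n with
  | zero => simp [rotY_zero]
  | succ n ih => rw [Nat.cast_succ, add_mul, one_mul, rotY_add, ih, pow_succ]

theorem continuous_rotY : Continuous rotY := by
  refine Continuous.subtype_mk (continuous_matrix fun i j => ?_) _
  fin_cases i <;> fin_cases j <;> simp [rotYMatrix] <;> fun_prop

theorem continuous_rotZ : Continuous rotZ := by
  refine Continuous.subtype_mk (continuous_matrix fun i j => ?_) _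
  fin_cases i <;> fin_cases j <;> simp [rotZMatrix] <;> fun_prop

theorem prod_ofFn_rotZ {M : ℕ} (a : Fin M → ℝ) :
    (List.ofFn fun m => rotZ (a m)).prod = rotZ (∑ m, a m) := by
  induction M with
  | zero => simp [rotZ_zero]
  | succ M ih => rw [List.ofFn_succ, List.prod_cons, ih, Fin.sum_univ_succ, rotZ_add]

/-! ### A Trotter estimate -/

theorem norm_unitary_eq_one (U : Matrix.unitaryGroup (Fin 2) ℂ) :
    ‖(U : Matrix (Fin 2) (Fin 2) ℂ)‖ = 1 :=
  CStarRing.norm_of_mem_unitary U.2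

/-- Telescoping: unitary factors have norm one, so errors only add. -/
theorem dist_pow_le_of_unitary (U V : Matrix.unitaryGroup (Fin 2) ℂ) (n : ℕ) :
    dist (U ^ n) (V ^ n) ≤ n * dist U V := by
  simp only [Subtype.dist_eq, dist_eq_norm]
  induction n with
  | zero => simp
  | succ n ih =>
    have h : ((U ^ (n + 1) : Matrix.unitaryGroup (Fin 2) ℂ) : Matrix (Fin 2) (Fin 2) ℂ) -
        (V ^ (n + 1) : Matrix.unitaryGroup (Fin 2) ℂ) =
        (U ^ n : Matrix.unitaryGroup (Fin 2) ℂ) * ((U : Matrix (Fin 2) (Fin 2) ℂ) - V) +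
        (((U ^ n : Matrix.unitaryGroup (Fin 2) ℂ) : Matrix (Fin 2) (Fin 2) ℂ) -
          (V ^ n : Matrix.unitaryGroup (Fin 2) ℂ)) * V := by
      simp only [pow_succ, Submonoid.coe_mul]
      noncomm_ring
    rw [h, Nat.cast_succ, add_mul, one_mul, add_comm (_ * ‖_‖)]
    refine (norm_add_le _ _).trans (add_le_add ?_ ?_)
    · refine (norm_mul_le _ _).trans ?_
      rw [norm_unitary_eq_one, one_mul]
    · refine (norm_mul_le _ _).trans ?_
      rwa [norm_unitary_eq_one, mul_one]

theorem abs_sub_sin_le {x : ℝ} (hx : |x| ≤ 1) : |x - Real.sin x| ≤ x ^ 2 := by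
  have h := Real.sin_bound hx
  have h3 : |x| ^ 3 ≤ |x| ^ 2 := pow_le_pow_of_le_one (abs_nonneg x) hx (by norm_num)
  have h4 : |x| ^ 4 ≤ |x| ^ 2 := pow_le_pow_of_le_one (abs_nonneg x) hx (by norm_num)
  have e : x - Real.sin x = x ^ 3 / 6 - (Real.sin x - (x - x ^ 3 / 6)) := by ring
  rw [e]
  refine (abs_sub _ _).trans ?_
  rw [abs_div, abs_pow, abs_of_pos (by norm_num : (0 : ℝ) < 6), ← sq_abs x]
  nlinarith [sq_nonneg |x|]

/-- Conjugating `R_y(s)` by `R_z(φ)` and by `R_z(-φ)` and multiplying the results. -/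
def conjRotYPair (φ s : ℝ) : Matrix.unitaryGroup (Fin 2) ℂ :=
  rotZ φ * rotY s * rotZ (-2 * φ) * rotY s * rotZ φ

/-- The error is expanded in unitaries, so its norm is at most the sum of the scalar coefficients,
each of order `s ^ 2`. -/
theorem conjRotYPair_sub_rotY (φ s : ℝ) :
    (conjRotYPair φ s : Matrix (Fin 2) (Fin 2) ℂ) - rotY (2 * s * Real.cos φ) =
      (Real.cos (s / 2) ^ 2 - Real.cos (s * Real.cos φ) : ℝ) • (1 : Matrix (Fin 2) (Fin 2) ℂ) +
      (Real.sin s * Real.cos φ - Real.sin (s * Real.cos φ) : ℝ) •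
        (rotY Real.pi : Matrix (Fin 2) (Fin 2) ℂ) -
      (Real.sin (s / 2) ^ 2 : ℝ) • (rotZ (4 * φ) : Matrix (Fin 2) (Fin 2) ℂ) := by
  have hs : Real.sin s = 2 * Real.sin (s / 2) * Real.cos (s / 2) := by
    rw [← Real.sin_two_mul]; ring_nf
  have hφ : 2 * (Real.cos φ : ℂ) = Complex.exp (Complex.I * φ) + Complex.exp (-(Complex.I * φ)) := by
    rw [Complex.ofReal_cos, Complex.two_cos]; ring_nf
  have hk : 2 * s * Real.cos φ / 2 = s * Real.cos φ := by ring
  have e1 : Complex.exp (Complex.I * φ) = Complex.exp (Complex.I * (φ / 2)) ^ 2 := by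
    rw [← Complex.exp_nat_mul]; push_cast; ring_nf
  have e2 : Complex.exp (-(Complex.I * φ)) = Complex.exp (-(Complex.I * (φ / 2))) ^ 2 := by
    rw [← Complex.exp_nat_mul]; push_cast; ring_nf
  have e3 : Complex.exp (-(Complex.I * ((4 * φ : ℝ) / 2))) =
      Complex.exp (-(Complex.I * (φ / 2))) ^ 4 := by
    rw [← Complex.exp_nat_mul]; push_cast; ring_nf
  have e4 : Complex.exp (Complex.I * ((4 * φ : ℝ) / 2)) =
      Complex.exp (Complex.I * (φ / 2)) ^ 4 := by
    rw [← Complex.exp_nat_mul]; push_cast; ring_nf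
  have e5 : Complex.exp (-(Complex.I * ((-2 * φ : ℝ) / 2))) =
      Complex.exp (Complex.I * (φ / 2)) ^ 2 := by
    rw [← Complex.exp_nat_mul]; push_cast; ring_nf
  have e6 : Complex.exp (Complex.I * ((-2 * φ : ℝ) / 2)) =
      Complex.exp (-(Complex.I * (φ / 2))) ^ 2 := by
    rw [← Complex.exp_nat_mul]; push_cast; ring_nf
  have hzw : Complex.exp (Complex.I * (φ / 2)) * Complex.exp (-(Complex.I * (φ / 2))) = 1 := by
    rw [← Complex.exp_add, add_neg_cancel, Complex.exp_zero]
  rw [hs]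
  simp only [conjRotYPair, rotY, rotZ, Submonoid.coe_mul, rotYMatrix, rotZMatrix, hk, e3, e4, e5, e6,
    Real.cos_pi_div_two, Real.sin_pi_div_two]
  -- What remains is polynomial algebra modulo `z * w = 1` and `z ^ 2 + w ^ 2 = 2 * κ`.
  rw [e1, e2] at hφ
  generalize Complex.exp (Complex.I * (φ / 2)) = z at *
  generalize Complex.exp (-(Complex.I * (φ / 2))) = w at *
  generalize Real.cos φ = κ at *
  generalize Real.cos (s * κ) = C
  generalize Real.sin (s * κ) = S
  generalize Real.cos (s / 2) = c
  generalize Real.sin (s / 2) = d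
  ext i j
  fin_cases i <;> fin_cases j <;>
    simp
  · linear_combination (c ^ 2 * (z * w + 1)) * hzw
  · linear_combination (c * d) * hφ - (c*d*(w^2+z^2)) * hzw
  · linear_combination -(c * d) * hφ + (c*d*(w^2+z^2)) * hzw
  · linear_combination (c ^ 2 * (z * w + 1)) * hzw

theorem dist_conjRotYPair_le {s : ℝ} (φ : ℝ) (hs : |s| ≤ 1) :
    dist (conjRotYPair φ s) (rotY (2 * s * Real.cos φ)) ≤ 4 * s ^ 2 := by
  rw [Subtype.dist_eq, dist_eq_norm, conjRotYPair_sub_rotY]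
  have hκ : |Real.cos φ| ≤ 1 := Real.abs_cos_le_one φ
  set κ := Real.cos φ
  have hκ2 : κ ^ 2 ≤ 1 := (sq_le_one_iff_abs_le_one κ).2 hκ
  have hsκ : |s * κ| ≤ 1 := by rw [abs_mul]; exact mul_le_one₀ hs (abs_nonneg _) hκ
  have hsκ2 : (s * κ) ^ 2 ≤ s ^ 2 := by nlinarith [sq_nonneg s]
  have hS : Real.sin (s / 2) ^ 2 ≤ s ^ 2 / 4 := by
    have := sq_le_sq' (neg_le_of_abs_le Real.abs_sin_le_abs) (le_of_abs_le Real.abs_sin_le_abs)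
      (a := Real.sin (s / 2)) (b := |s / 2|)
    rw [sq_abs] at this; linarith
  have h1 : |Real.cos (s / 2) ^ 2 - Real.cos (s * κ)| ≤ s ^ 2 := by
    have := Real.one_sub_sq_div_two_le_cos (x := s * κ)
    have := Real.cos_le_one (s * κ)
    have := Real.sin_sq_add_cos_sq (s / 2)
    rw [abs_le]
    constructor <;> nlinarith [sq_nonneg s]
  have h2 : |Real.sin s * κ - Real.sin (s * κ)| ≤ 2 * s ^ 2 := by
    have a1 := abs_sub_sin_le hs
    have a2 := abs_sub_sin_le hsκ
    have e : Real.sin s * κ - Real.sin (s * κ) =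
        (s * κ - Real.sin (s * κ)) - (s - Real.sin s) * κ := by ring
    rw [e]
    refine (abs_sub _ _).trans ?_
    rw [abs_mul]
    have := mul_le_of_le_one_right (abs_nonneg (s - Real.sin s)) hκ
    linarith
  refine (norm_sub_le _ _).trans ((add_le_add_left (norm_add_le _ _) _).trans ?_)
  simp only [norm_smul, norm_unitary_eq_one, Real.norm_eq_abs, CStarRing.norm_one, mul_one]
  rw [abs_of_nonneg (sq_nonneg (Real.sin (s / 2)))]
  -- The three terms contribute `1 + 2 + 1/4 ≤ 4` times `s ^ 2`.
  nlinarith [sq_nonneg s]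

theorem dist_conjRotYPair_pow_le (φ a : ℝ) {n : ℕ} (hn : |a| ≤ n) :
    dist (conjRotYPair φ (a / n) ^ n) (rotY (2 * a * Real.cos φ)) ≤ 4 * a ^ 2 / n := by
  rcases Nat.eq_zero_or_pos n with rfl | hpos
  · have : a = 0 := by simpa using hn
    simp [this, rotY_zero]
  have hn0 : (0 : ℝ) < n := by exact_mod_cast hpos
  have e : 2 * a * Real.cos φ = n * (2 * (a / n) * Real.cos φ) := by field_simp
  rw [e, rotY_nsmul]
  refine (dist_pow_le_of_unitary _ _ _).trans ?_
  refine (mul_le_mul_of_nonneg_left (dist_conjRotYPair_le φ ?_) hn0.le).trans_eq ?_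
  · rwa [abs_div, Nat.abs_cast, div_le_one hn0]
  · field_simp

/-! ### Circuits with affine phases -/

/-- The affine functions on the unit cube. -/
def affinePhases (M : ℕ) : Submodule ℝ C(UnitCube M, ℝ) where
  carrier := {φ | ∃ (w : Fin M → ℝ) (b : ℝ), ∀ x, φ x = ∑ m, x.1 m * w m + b}
  zero_mem' := ⟨0, 0, by simp⟩
  add_mem' := by
    rintro φ ψ ⟨w, b, h⟩ ⟨v, c, k⟩
    refine ⟨w + v, b + c, fun x => ?_⟩
    simp only [ContinuousMap.add_apply, h, k, Pi.add_apply, mul_add, Finset.sum_add_distrib]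
    ring
  smul_mem' := by
    rintro t φ ⟨w, b, h⟩
    refine ⟨t • w, t * b, fun x => ?_⟩
    simp only [ContinuousMap.smul_apply, h, Pi.smul_apply, smul_eq_mul, mul_add, Finset.mul_sum]
    congr 1
    exact Finset.sum_congr rfl fun m _ => by ring

/-- The circuit with a single layer `R_y(α) R_z(φ)`. -/
def singleLayer {M : ℕ} (α : ℝ) (φ : C(UnitCube M, ℝ)) :
    C(UnitCube M, Matrix.unitaryGroup (Fin 2) ℂ) :=
  ⟨fun x => rotY α * rotZ (φ x), continuous_const.mul (continuous_rotZ.comp φ.continuous)⟩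

/-- The monoid generated by single layers with affine phases. -/
def circuits (M : ℕ) : Submonoid C(UnitCube M, Matrix.unitaryGroup (Fin 2) ℂ) :=
  Submonoid.closure {U | ∃ α, ∃ φ ∈ affinePhases M, U = singleLayer α φ}

theorem isSingleQubitCircuit_one {M : ℕ} :
    IsSingleQubitCircuit (1 : UnitCube M → Matrix.unitaryGroup (Fin 2) ℂ) :=
  ⟨0, 0, fun x => by simp [reuploadingCircuit]⟩

theorem IsSingleQubitCircuit.singleLayer_mul {M : ℕ} {α : ℝ} {φ : C(UnitCube M, ℝ)}
    (hφ : φ ∈ affinePhases M) {V : UnitCube M → Matrix.unitaryGroup (Fin 2) ℂ}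
    (hV : IsSingleQubitCircuit V) : IsSingleQubitCircuit (⇑(singleLayer α φ) * V) := by
  obtain ⟨w, b, h⟩ := hφ
  obtain ⟨L, θ, hθ⟩ := hV
  -- The weights `w` fill the data slots and the offset `b` the final `R_z`, since `R_z` angles add.
  refine ⟨L + 1, Matrix.of fun j => Fin.cons
    ((Fin.cons α (Fin.snoc w b : Fin (M + 1) → ℝ) : Fin (M + 2) → ℝ) j) (θ j), fun x => ?_⟩
  have hsucc (m : Fin M) : m.succ.castSucc = m.castSucc.succ := rfl
  rw [Pi.mul_apply, hθ, reuploadingCircuit, reuploadingCircuit, List.ofFn_succ, List.prod_cons]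
  congr 1
  simp only [Matrix.of_apply, Fin.cons_zero, hsucc, Fin.cons_succ, Fin.snoc_castSucc,
    ← Fin.succ_last, Fin.snoc_last, prod_ofFn_rotZ, mul_assoc, ← rotZ_add]
  simp [singleLayer, h]

theorem isSingleQubitCircuit_of_mem_circuits {M : ℕ}
    {U : C(UnitCube M, Matrix.unitaryGroup (Fin 2) ℂ)} (hU : U ∈ circuits M) :
    IsSingleQubitCircuit U := by
  induction hU using Submonoid.closure_induction_left with
  | one => exact isSingleQubitCircuit_one
  | mul_left U hU V _ hV =>
    obtain ⟨α, φ, hφ, rfl⟩ := hU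
    exact hV.singleLayer_mul hφ

theorem exists_mem_circuits_eq_conjRotYPair {M : ℕ} {φ : C(UnitCube M, ℝ)}
    (hφ : φ ∈ affinePhases M) (s : ℝ) :
    ∃ U ∈ circuits M, ∀ x, U x = conjRotYPair (φ x) s := by
  have mem (α : ℝ) (t : ℝ) : singleLayer α (t • φ) ∈ circuits M :=
    Submonoid.subset_closure ⟨α, t • φ, Submodule.smul_mem _ t hφ, rfl⟩
  -- Every layer starts with an `R_y`; angle `0` makes the first one a bare `R_z(φ)`.
  refine ⟨singleLayer 0 ((1 : ℝ) • φ) * singleLayer s ((-2 : ℝ) • φ) *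
    singleLayer s ((1 : ℝ) • φ), mul_mem (mul_mem (mem _ _) (mem _ _)) (mem _ _), fun x => ?_⟩
  simp [singleLayer, conjRotYPair, rotY_zero, mul_assoc]

/-! ### Angles of approximable rotations -/

/-- `x ↦ R_y(p(x))`. -/
def rotYComp {M : ℕ} (p : C(UnitCube M, ℝ)) : C(UnitCube M, Matrix.unitaryGroup (Fin 2) ℂ) :=
  (⟨rotY, continuous_rotY⟩ : C(ℝ, Matrix.unitaryGroup (Fin 2) ℂ)).comp p

/-- The continuous functions `p` such that circuits uniformly approximate `x ↦ R_y(t p(x))` for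
every real `t`. -/
def reachableAngles (M : ℕ) : Submodule ℝ C(UnitCube M, ℝ) where
  carrier := {p | ∀ t : ℝ, rotYComp (t • p) ∈ (circuits M).topologicalClosure}
  zero_mem' t := by
    have : rotYComp (t • (0 : C(UnitCube M, ℝ))) = 1 := by
      ext1 x; simp [rotYComp, rotY_zero]
    rw [this]; exact one_mem _
  add_mem' {p q} hp hq t := by
    have : rotYComp (t • (p + q)) = rotYComp (t • p) * rotYComp (t • q) := by
      ext1 x; simp [rotYComp, rotY_add]
    rw [this]; exact mul_mem (hp t) (hq t)
  smul_mem' c p hp t := by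
    rw [smul_smul]; exact hp _

theorem isClosed_reachableAngles (M : ℕ) : IsClosed (reachableAngles M : Set C(UnitCube M, ℝ)) := by
  have : (reachableAngles M : Set C(UnitCube M, ℝ)) =
      ⋂ t : ℝ, (fun p => rotYComp (t • p)) ⁻¹' ((circuits M).topologicalClosure : Set _) := by
    ext p; simp [reachableAngles]
  rw [this]
  exact isClosed_iInter fun t => (Submonoid.isClosed_topologicalClosure _).preimage
    ((continuous_postcomp _).comp (continuous_const_smul t))

/-- `x ↦ cos (p(x))`. -/
def cosComp {M : ℕ} (p : C(UnitCube M, ℝ)) : C(UnitCube M, ℝ) :=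
  (⟨Real.cos, Real.continuous_cos⟩ : C(ℝ, ℝ)).comp p

theorem cosComp_mem_reachableAngles {M : ℕ} {φ : C(UnitCube M, ℝ)} (hφ : φ ∈ affinePhases M) :
    cosComp φ ∈ reachableAngles M := by
  intro t
  -- Halving `t` offsets the factor 2 in the angle `2 a cos φ`.
  choose U hU hUφ using fun n : ℕ => exists_mem_circuits_eq_conjRotYPair hφ (t / 2 / n)
  refine mem_closure_of_tendsto (f := fun n => U n ^ n) (b := atTop) ?_
    (Eventually.of_forall fun n => pow_mem (hU n) n)
  have hlim : Tendsto (fun n : ℕ => 4 * (t / 2) ^ 2 / (n : ℝ)) atTop (𝓝 0) :=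
    tendsto_const_div_atTop_nhds_zero_nat _
  refine tendsto_iff_dist_tendsto_zero.2 (squeeze_zero' (Eventually.of_forall fun _ => dist_nonneg)
    ?_ hlim)
  filter_upwards [eventually_ge_atTop ⌈|t / 2|⌉₊] with n hn
  refine (ContinuousMap.dist_le (by positivity)).2 fun x => ?_
  have := dist_conjRotYPair_pow_le (φ x) (t / 2) (Nat.ceil_le.1 hn)
  rw [mul_div_cancel₀ t (two_ne_zero)] at this
  simpa [hUφ, rotYComp, cosComp] using this

/-- The algebra of trigonometric polynomials on the unit cube with arbitrary real frequencies. -/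
def trigPolynomials (M : ℕ) : Subalgebra ℝ C(UnitCube M, ℝ) :=
  (Submodule.span ℝ (cosComp '' (affinePhases M : Set C(UnitCube M, ℝ)))).toSubalgebra
    (Submodule.subset_span ⟨0, zero_mem _, by ext x; simp [cosComp]⟩) fun p q hp hq => by
      refine (?_ : Submodule.span ℝ _ * Submodule.span ℝ _ ≤ Submodule.span ℝ _)
        (Submodule.mul_mem_mul hp hq)
      rw [Submodule.span_mul_span, Submodule.span_le]
      rintro _ ⟨_, ⟨φ, hφ, rfl⟩, _, ⟨ψ, hψ, rfl⟩, rfl⟩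
      have : cosComp φ * cosComp ψ =
          (1 / 2 : ℝ) • cosComp (φ + ψ) + (1 / 2 : ℝ) • cosComp (φ - ψ) := by
        ext x
        simp [cosComp, Real.cos_add, Real.cos_sub]
        ring
      change cosComp φ * cosComp ψ ∈ _
      rw [this]
      exact add_mem (Submodule.smul_mem _ _ (Submodule.subset_span ⟨_, add_mem hφ hψ, rfl⟩))
        (Submodule.smul_mem _ _ (Submodule.subset_span ⟨_, sub_mem hφ hψ, rfl⟩))

theorem trigPolynomials_separatesPoints (M : ℕ) : (trigPolynomials M).SeparatesPoints := by
  intro x y hxy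
  obtain ⟨m, hm⟩ : ∃ m, x.1 m ≠ y.1 m := by
    by_contra! h
    exact hxy (Subtype.ext (funext h))
  let φ : C(UnitCube M, ℝ) := ⟨fun z => z.1 m, (continuous_apply m).comp continuous_subtype_val⟩
  have hφ : φ ∈ affinePhases M := ⟨Pi.single m 1, 0, fun z => by simp [φ, Pi.single_apply]⟩
  refine ⟨cosComp φ, ⟨cosComp φ, Submodule.subset_span ⟨φ, hφ, rfl⟩, rfl⟩, fun h => hm ?_⟩
  -- Coordinates lie in `[0, 1] ⊆ [0, π]`, where cosine is injective.
  have mem (z : UnitCube M) : z.1 m ∈ Set.Icc 0 Real.pi :=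
    ⟨z.2.1 m, (z.2.2 m).trans (by simpa using Real.pi_gt_three.le.trans' (by norm_num))⟩
  exact Real.injOn_cos (mem x) (mem y) h

theorem reachableAngles_eq_top (M : ℕ) : reachableAngles M = ⊤ := by
  refine eq_top_iff.2 fun p _ => ?_
  have hle : (trigPolynomials M : Set C(UnitCube M, ℝ)) ⊆ reachableAngles M := by
    change Submodule.span ℝ _ ≤ reachableAngles M
    rw [Submodule.span_le]
    rintro _ ⟨φ, hφ, rfl⟩
    exact cosComp_mem_reachableAngles hφ
  have hp : p ∈ (trigPolynomials M).topologicalClosure := by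
    rw [subalgebra_topologicalClosure_eq_top_of_separatesPoints _
      (trigPolynomials_separatesPoints M)]
    trivial
  exact closure_minimal hle (isClosed_reachableAngles M) hp

theorem rotYComp_mem_closure_circuits {M : ℕ} (p : C(UnitCube M, ℝ)) :
    rotYComp p ∈ (circuits M).topologicalClosure := by
  have : p ∈ reachableAngles M := reachableAngles_eq_top M ▸ Submodule.mem_top
  simpa using this 1

/-! ### Expectation values -/

/-- The Pauli matrix `Z`. -/
def pauliZ : Matrix (Fin 2) (Fin 2) ℂ := Matrix.diagonal ![1, -1]

theorem isHermitian_pauliZ : pauliZ.IsHermitian := by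
  refine Matrix.isHermitian_diagonal_of_self_adjoint _ ?_
  ext i
  fin_cases i <;> simp

theorem norm_pauliZ : ‖pauliZ‖ = 1 := by
  rw [pauliZ, Matrix.l2_opNorm_diagonal]
  simp [Pi.norm_def, Fin.univ_succ]

theorem continuous_expectationValue (O : Matrix (Fin 2) (Fin 2) ℂ) :
    Continuous fun U => expectationValue U O := by
  unfold expectationValue
  fun_prop

theorem expectationValue_rotY (a : ℝ) : expectationValue (rotY a) pauliZ = Real.cos a := by
  have : (Real.cos a : ℂ) = Real.cos (a / 2) ^ 2 - Real.sin (a / 2) ^ 2 := by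
    rw [← Complex.ofReal_pow, ← Complex.ofReal_pow, ← Complex.ofReal_sub, ← Real.cos_two_mul',
      mul_div_cancel₀ a two_ne_zero]
  rw [this]
  simp [expectationValue, ketZero, pauliZ, rotY, rotYMatrix, Matrix.mul_apply, Matrix.mulVec,
    dotProduct, Fin.sum_univ_two, Matrix.diagonal, ← Complex.cos_conj, ← Complex.sin_conj,
    map_ofNat (starRingEnd ℂ) 2]
  ring

theorem exists_circuit_expectationValue_near_cos {M : ℕ} (p : C(UnitCube M, ℝ)) {ε : ℝ}
    (hε : 0 < ε) :
    ∃ U : UnitCube M → Matrix.unitaryGroup (Fin 2) ℂ, IsSingleQubitCircuit U ∧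
      ∀ x, dist (expectationValue (U x) pauliZ) (Real.cos (p x)) < ε := by
  let E : C(Matrix.unitaryGroup (Fin 2) ℂ, ℂ) := ⟨_, continuous_expectationValue pauliZ⟩
  have hmem : E.comp (rotYComp p) ∈ closure (E.comp '' (circuits M : Set _)) :=
    image_closure_subset_closure_image (continuous_postcomp E)
      ⟨_, rotYComp_mem_closure_circuits p, rfl⟩
  obtain ⟨_, ⟨U, hU, rfl⟩, hdist⟩ := Metric.mem_closure_iff.1 hmem ε hε
  refine ⟨U, isSingleQubitCircuit_of_mem_circuits hU, fun x => ?_⟩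
  have := (ContinuousMap.dist_apply_le_dist x).trans_lt hdist
  rw [dist_comm]
  simpa [E, rotYComp, expectationValue_rotY] using this

/-! ### Piecewise continuous maps -/

/-- Open subsets of a metric space are countable unions of closed sets. -/
theorem IsLocallyClosed.exists_iUnion_isClosed {X : Type*} [PseudoMetricSpace X] {A : Set X}
    (hA : IsLocallyClosed A) : ∃ C : ℕ → Set X, (∀ n, IsClosed (C n)) ∧ ⋃ n, C n = A := by
  obtain ⟨U, Z, hU, hZ, rfl⟩ := hA
  obtain ⟨F, hF, -, hFU, -⟩ := hU.exists_iUnion_isClosed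
  exact ⟨fun n => F n ∩ Z, fun n => (hF n).inter hZ, by rw [← Set.iUnion_inter, hFU]⟩

theorem ContinuousOn.biUnion_lt_of_isClosed {X Y : Type*} [TopologicalSpace X] [TopologicalSpace Y]
    {f : X → Y} {C : ℕ → Set X} (hC : ∀ n, IsClosed (C n)) (hf : ∀ n, ContinuousOn f (C n))
    (k : ℕ) : ContinuousOn f (⋃ n < k, C n) := by
  induction k with
  | zero => simp
  | succ k ih =>
    rw [Set.biUnion_lt_succ]
    exact ih.union_of_isClosed (hf k) ((Set.finite_lt_nat k).isClosed_biUnion fun n _ => hC n) (hC k)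

/-- A piecewise continuous map on a metric space is continuous on the members of an increasing
sequence of closed sets that exhausts the space. -/
theorem PiecewiseContinuous.exists_isClosed_eventually_mem {X Y : Type*} [PseudoMetricSpace X]
    [TopologicalSpace Y] {f : X → Y} (hf : PiecewiseContinuous f) :
    ∃ K : ℕ → Set X, (∀ k, IsClosed (K k)) ∧ (∀ k, ContinuousOn f (K k)) ∧
      ∀ x, ∀ᶠ k in atTop, x ∈ K k := by
  obtain ⟨A, hA, hcover, hcont⟩ := hf
  choose C hC hCA using fun n => (hA n).exists_iUnion_isClosed
  let D (n : ℕ) : Set X := C n.unpair.1 n.unpair.2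
  have hD (n : ℕ) : IsClosed (D n) := hC _ _
  have hfD (n : ℕ) : ContinuousOn f (D n) :=
    (hcont n.unpair.1).mono ((Set.subset_iUnion (C n.unpair.1) _).trans (hCA _).le)
  refine ⟨fun k => ⋃ n < k, D n, fun k => (Set.finite_lt_nat k).isClosed_biUnion fun n _ => hD n,
    ContinuousOn.biUnion_lt_of_isClosed hD hfD, fun x => ?_⟩
  obtain ⟨i, hi⟩ := Set.mem_iUnion.1 (hcover ▸ Set.mem_univ x)
  obtain ⟨j, hj⟩ := Set.mem_iUnion.1 (hCA i ▸ hi)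
  filter_upwards [eventually_gt_atTop (Nat.pair i j)] with k hk
  exact Set.mem_biUnion (show Nat.pair i j < k from hk) (by simpa [D] using hj)

/-- Tietze applied to `arccos ∘ h` on `K`. The extension may leave `[0, π]`, which is harmless. -/
theorem exists_continuousMap_cos_eqOn {X : Type*} [TopologicalSpace X] [NormalSpace X]
    {K : Set X} (hK : IsClosed K) {h : X → ℝ} (hh : ContinuousOn h K)
    (hbound : ∀ x, h x ∈ Set.Icc (-1) 1) :
    ∃ p : C(X, ℝ), ∀ x ∈ K, Real.cos (p x) = h x := by
  obtain ⟨p, hp⟩ := ContinuousMap.exists_restrict_eq hK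
    ⟨fun x : K => Real.arccos (h x), Real.continuous_arccos.comp hh.domRestrict⟩
  refine ⟨p, fun x hx => ?_⟩
  have : p x = Real.arccos (h x) := congr($hp ⟨x, hx⟩)
  rw [this, Real.cos_arccos (hbound x).1 (hbound x).2]

end

theorem theorem2 (M : ℕ) (f : UnitCube M → Set.Icc (-1 : Fin M → ℝ) 1)
    (hf : PiecewiseContinuous f) :
    ∃ (U : ℕ → Fin M → UnitCube M → Matrix.unitaryGroup (Fin 2) ℂ)
      (O : ℕ → Fin M → Matrix (Fin 2) (Fin 2) ℂ),
      (∀ k m, IsSingleQubitCircuit (U k m)) ∧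
      (∀ k m, (O k m).IsHermitian ∧ ‖O k m‖ = 1) ∧
      ∀ x : UnitCube M,
        Tendsto (fun k (m : Fin M) => expectationValue (U k m x) (O k m)) atTop
          (𝓝 fun m => (((f x : Fin M → ℝ) m : ℝ) : ℂ)) := by
  obtain ⟨K, hK, hfK, hmem⟩ := hf.exists_isClosed_eventually_mem
  have hcont (k : ℕ) (m : Fin M) : ContinuousOn (fun x => (f x : Fin M → ℝ) m) (K k) :=
    ((continuous_apply m).comp continuous_subtype_val).comp_continuousOn (hfK k)
  choose p hp using fun (k : ℕ) (m : Fin M) =>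
    exists_continuousMap_cos_eqOn (hK k) (hcont k m) fun x => ⟨(f x).2.1 m, (f x).2.2 m⟩
  -- The tolerance `1 / (k + 1)` holds on the whole cube; only `cos (p k m x) = f x m` needs `x ∈ K
  -- k`.
  choose U hU hUp using fun (k : ℕ) (m : Fin M) =>
    exists_circuit_expectationValue_near_cos (p k m) (Nat.one_div_pos_of_nat (n := k) (α := ℝ))
  refine ⟨U, fun _ _ => pauliZ, hU, fun _ _ => ⟨isHermitian_pauliZ, norm_pauliZ⟩, fun x => ?_⟩
  refine tendsto_pi_nhds.2 fun m => tendsto_iff_dist_tendsto_zero.2 ?_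
  refine squeeze_zero' (Eventually.of_forall fun _ => dist_nonneg) ?_
    tendsto_one_div_add_atTop_nhds_zero_nat
  filter_upwards [hmem x] with k hk
  rw [← hp k m x hk]
  exact (hUp k m x).le
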